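/- **Setting.** Let $\Omega\subset\mathbb R^3$ be a bounded open set (for instance a bounded domain with smooth boundary). Let $H$ be the closure in $(L^2(\Omega))^3$ of $\{\varphi\in (C_0^\infty(\Omega))^3:\nabla\cdot\varphi=0\}$, let $V=(H^1_0(\Omega))^3\cap H$ with $\|v\|_1=\|\nabla v\|_{L^2(\Omega)}$, and let $V'$ be the dual of $V$ with the norm $\|\cdot\|_{-1}$ dual to $\|\cdot\|_1$. Write $\|\cdot\|$ for the $L^2$ norm. Let $A:V\to V'$, $\langle Av,\varphi\rangle=(\nabla v,\nabla\varphi)$, be the Stokes operator with homogeneous Dirichlet boundary conditions, and let $B:V\times V\to V'$, $\langle B(u,v),\varphi\rangle=\int_\Omega ((u\cdot\nabla)v)\cdot\varphi\,dx$. Let $w_1,w_2,\dots\in V$ be an orthonormal basis of $H$ consisting of eigenfunctions, $Aw_j=\lambda_jw_j$, with $\lambda_1\le\lambda_2\le\cdots$ (repeated according to multiplicity), and let $P_m$ be the $L^2$-orthogonal projection onto $\operatorname{span}\{w_1,\dots,w_m\}$, $m\ge 0$. Let $\nu,\alpha>0$ and $d_1=\tfrac12\min\{\alpha^{-2},\lambda_1\}$.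 For $h:\mathbb R\to V'$ and $v_0\in V$, a solution of the Navier–Stokes–Voight problem $$v_t+\nu Av+\alpha^2Av_t+B(v,v)=h(t),\qquad v(0)=v_0, \tag{1}$$ is a locally absolutely continuous function $v:[0,\infty)\to V$, the primitive of some $v_t\in L^1_{loc}([0,\infty);V)$, that has $v(0)=v_0$ and satisfies the equation in $V'$ for almost every $t>0$. **Theorem 4.1.** There is a constant $C>0$, independent of $\Omega,\nu,\alpha,m$ and of the forces and solutions (in particular dimensionless and scale invariant), such that the following holds in the above setting. Let $v$ be a solution of (1) with force $h$ and initial value $v_0\in V$, and let $u$ be a solution of (1) with force $g$ and initial value $u_0\in V$. Assume that $\|h(t)\|_{-1}\le\mathbf h<\infty$ for all $t\ge0$, that $$\lim_{t\to\infty}\|h(t)-g(t)\|_{-1}=0\quad\text{and}\quad \lim_{t\to\infty}\|P_m(v(t)-u(t))\|=0,$$ and that $$\lambda_{m+1}>C\,\frac{\mathbf h^4}{\alpha^4\nu^8d_1^2}.$$ Then $\lim_{t\to\infty}\|v(t)-u(t)\|_1=0$; that is, the first $m$ eigenfunctions of the Stokes operator are asymptotically determining for the Navier–Stokes–Voight equations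 with homogeneous Dirichlet boundary conditions. -/

import Mathlib

open MeasureTheory Set Filter Topology
open scoped ContDiff

noncomputable section

namespace NSV

/-- Physical space `ℝ³` with its Euclidean norm. -/
abbrev E3 : Type := EuclideanSpace ℝ (Fin 3)

/-- `3 × 3` gradients with the Euclidean (Frobenius) norm: the `i`-th entry is `∂ᵢ v ∈ ℝ³`. -/
abbrev Grad3 : Type := PiLp 2 (fun _ : Fin 3 => E3)

/-- `(L²(Ω))³`, with inner product `∑ⱼ (uⱼ, vⱼ)_{L²(Ω)}`. -/
abbrev L2Vec (Ω : Set E3) : Type := Lp E3 2 (volume.restrict Ω)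

/-- Square integrable gradient fields, with inner product `∑ᵢⱼ (Fᵢⱼ, Gᵢⱼ)_{L²(Ω)}`. -/
abbrev L2Grad (Ω : Set E3) : Type := Lp Grad3 2 (volume.restrict Ω)

/-- The classical gradient `(∂₁ φ, ∂₂ φ, ∂₃ φ)` of a vector field. -/
def gradField (φ : E3 → E3) (x : E3) : Grad3 :=
  WithLp.toLp 2 fun i => fderiv ℝ φ x (EuclideanSpace.single i 1)

/-- The classical divergence of a vector field. -/
def divField (φ : E3 → E3) (x : E3) : ℝ :=
  ∑ i, fderiv ℝ φ x (EuclideanSpace.single i 1) i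

/-- `φ ∈ (C₀^∞(Ω))³`, extended by zero to `ℝ³`. -/
structure IsTestField (Ω : Set E3) (φ : E3 → E3) : Prop where
  smooth : ContDiff ℝ ∞ φ
  compact : HasCompactSupport φ
  support : tsupport φ ⊆ Ω

theorem IsTestField.zero (Ω : Set E3) : IsTestField Ω (0 : E3 → E3) where
  smooth := contDiff_const
  compact := HasCompactSupport.zero
  support := by simp [tsupport]

theorem IsTestField.add {Ω : Set E3} {φ ψ : E3 → E3} (hφ : IsTestField Ω φ)
    (hψ : IsTestField Ω ψ) : IsTestField Ω (φ + ψ) where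
  smooth := hφ.smooth.add hψ.smooth
  compact := hφ.compact.add hψ.compact
  support := (tsupport_add φ ψ).trans (union_subset hφ.support hψ.support)

theorem IsTestField.smul {Ω : Set E3} {φ : E3 → E3} (c : ℝ) (hφ : IsTestField Ω φ) :
    IsTestField Ω (c • φ) where
  smooth := contDiff_const.smul hφ.smooth
  compact := hφ.compact.smul_left (f := fun _ => c)
  support := (closure_mono (Function.support_const_smul_subset c φ)).trans hφ.support

theorem IsTestField.differentiable {Ω : Set E3} {φ : E3 → E3} (hφ : IsTestField Ω φ) :
    Differentiable ℝ φ :=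
  hφ.smooth.differentiable (by simp)

theorem gradField_zero : gradField (0 : E3 → E3) = 0 := by
  funext x; ext i j; simp [gradField]

theorem gradField_add {φ ψ : E3 → E3} (hφ : Differentiable ℝ φ) (hψ : Differentiable ℝ ψ) :
    gradField (φ + ψ) = gradField φ + gradField ψ := by
  funext x; ext i j; simp [gradField, fderiv_add (hφ x) (hψ x)]

theorem gradField_smul {φ : E3 → E3} (c : ℝ) (hφ : Differentiable ℝ φ) :
    gradField (c • φ) = c • gradField φ := by
  funext x; ext i j; simp [gradField, fderiv_const_smul (hφ x) c]

theorem divField_zero : divField (0 : E3 → E3) = 0 := by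
  funext x; simp [divField]

theorem divField_add {φ ψ : E3 → E3} (hφ : Differentiable ℝ φ) (hψ : Differentiable ℝ ψ) :
    divField (φ + ψ) = divField φ + divField ψ := by
  funext x; simp [divField, fderiv_add (hφ x) (hψ x), Finset.sum_add_distrib]

theorem divField_smul {φ : E3 → E3} (c : ℝ) (hφ : Differentiable ℝ φ) :
    divField (c • φ) = c • divField φ := by
  funext x; simp [divField, fderiv_const_smul (hφ x) c, Finset.mul_sum]

/-- The classes in `(L²(Ω))³` of the divergence free test fields (the paper's script `V`). -/
def solenoidalTest (Ω : Set E3) : Submodule ℝ (L2Vec Ω) where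
  carrier := {u | ∃ φ : E3 → E3, IsTestField Ω φ ∧ divField φ = 0 ∧ u =ᵐ[volume.restrict Ω] φ}
  zero_mem' := ⟨0, IsTestField.zero Ω, divField_zero, Lp.coeFn_zero _ _ _⟩
  add_mem' := by
    rintro u v ⟨φ, hφ, dφ, eφ⟩ ⟨ψ, hψ, dψ, eψ⟩
    exact ⟨φ + ψ, hφ.add hψ, by rw [divField_add hφ.differentiable hψ.differentiable, dφ, dψ,
      add_zero], (Lp.coeFn_add u v).trans (eφ.add eψ)⟩
  smul_mem' := by
    rintro c u ⟨φ, hφ, dφ, eφ⟩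
    exact ⟨c • φ, hφ.smul c, by rw [divField_smul c hφ.differentiable, dφ, smul_zero],
      (Lp.coeFn_smul c u).trans (eφ.const_smul c)⟩

/-- `H`: the closure of the divergence free test fields in `(L²(Ω))³`. -/
def H (Ω : Set E3) : Submodule ℝ (L2Vec Ω) := (solenoidalTest Ω).topologicalClosure

/-- The pairs `(φ, ∇φ)` with `φ ∈ (C₀^∞(Ω))³`. -/
def testGraph (Ω : Set E3) : Submodule ℝ (L2Vec Ω × L2Grad Ω) where
  carrier := {p | ∃ φ : E3 → E3, IsTestField Ω φ ∧ p.1 =ᵐ[volume.restrict Ω] φ ∧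
    p.2 =ᵐ[volume.restrict Ω] gradField φ}
  zero_mem' := ⟨0, IsTestField.zero Ω, Lp.coeFn_zero _ _ _, by
    rw [gradField_zero]; exact Lp.coeFn_zero _ _ _⟩
  add_mem' := by
    rintro u v ⟨φ, hφ, eφ, fφ⟩ ⟨ψ, hψ, eψ, fψ⟩
    refine ⟨φ + ψ, hφ.add hψ, (Lp.coeFn_add u.1 v.1).trans (eφ.add eψ), ?_⟩
    rw [gradField_add hφ.differentiable hψ.differentiable]
    exact (Lp.coeFn_add u.2 v.2).trans (fφ.add fψ)
  smul_mem' := by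
    rintro c u ⟨φ, hφ, eφ, fφ⟩
    refine ⟨c • φ, hφ.smul c, (Lp.coeFn_smul c u.1).trans (eφ.const_smul c), ?_⟩
    rw [gradField_smul c hφ.differentiable]
    exact (Lp.coeFn_smul c u.2).trans (fφ.const_smul c)

/-- `(H¹₀(Ω))³`: the closure of the test fields in the `H¹` topology. An element is stored as the
pair `(u, ∇u)` of the field and its weak gradient. -/
def H10 (Ω : Set E3) : Submodule ℝ (L2Vec Ω × L2Grad Ω) := (testGraph Ω).topologicalClosure

/-- `V = (H¹₀(Ω))³ ∩ H`. The norm that Lean puts on this type is a norm of the `H¹` topology; the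
norm `‖·‖₁` used in the theory is `norm1` below. -/
def V (Ω : Set E3) : Submodule ℝ (L2Vec Ω × L2Grad Ω) :=
  H10 Ω ⊓ (H Ω).comap (LinearMap.fst ℝ (L2Vec Ω) (L2Grad Ω))

theorem isClosed_V (Ω : Set E3) : IsClosed (V Ω : Set (L2Vec Ω × L2Grad Ω)) :=
  (Submodule.isClosed_topologicalClosure _).inter
    ((Submodule.isClosed_topologicalClosure (solenoidalTest Ω)).preimage continuous_fst)

instance (Ω : Set E3) : CompleteSpace (V Ω) := (isClosed_V Ω).completeSpace_coe

variable {Ω : Set E3}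

/-- The underlying `L²` field of `v ∈ V`. -/
def fld (v : V Ω) : L2Vec Ω := v.1.1

/-- The weak gradient of `v ∈ V`. -/
def grad (v : V Ω) : L2Grad Ω := v.1.2

/-- `‖v‖₁ = ‖∇v‖_{L²}`. -/
def norm1 (v : V Ω) : ℝ := ‖grad v‖

/-- The norm `‖ℓ‖₋₁` of `ℓ ∈ V'`, dual to `‖·‖₁`: the least `c ≥ 0` with `|ℓ(φ)| ≤ c ‖φ‖₁` on
`V`. -/
def normNeg1 (l : V Ω →L[ℝ] ℝ) : ℝ := sInf {c : ℝ | 0 ≤ c ∧ ∀ φ : V Ω, |l φ| ≤ c * norm1 φ}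

/-- The trilinear form `b(u,v,w) = ⟨B(u,v),w⟩ = ∫_Ω ((u·∇)v)·w dx = ∫_Ω ∑ᵢ uᵢ (∂ᵢv · w) dx`. -/
def trilin (u v w : V Ω) : ℝ :=
  ∫ x in Ω, ∑ i : Fin 3, fld u x i * inner ℝ (grad v x i) (fld w x)

/-- `v` solves `v_t + ν A v + α² A v_t + B(v,v) = h` in `V'` for almost every `t > 0`, with
`v(0) = v₀ ∈ V`: here `v` is locally absolutely continuous from `[0,∞)` to `V` (the primitive of a
locally Bochner integrable `v_t`), and `⟨A v, φ⟩ = (∇v, ∇φ)`, `⟨B(v,v), φ⟩ = b(v,v,φ)`. -/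
def IsSolution (ν α : ℝ) (h : ℝ → (V Ω →L[ℝ] ℝ)) (v₀ : V Ω) (v : ℝ → V Ω) : Prop :=
  ∃ vt : ℝ → V Ω,
    LocallyIntegrableOn vt (Ici 0) ∧
    (∀ t, 0 ≤ t → v t = v₀ + ∫ s in (0 : ℝ)..t, vt s) ∧
    ∀ᵐ t ∂(volume.restrict (Ici (0 : ℝ))), ∀ φ : V Ω,
      inner ℝ (fld (vt t)) (fld φ) + ν * inner ℝ (grad (v t)) (grad φ)
        + α ^ 2 * inner ℝ (grad (vt t)) (grad φ) + trilin (v t) (v t) φ = h t φ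

/-- `(w j)` is an orthonormal basis of `H` made of eigenfunctions `A w_j = lam_j w_j` of the Stokes
operator, where the eigenvalues are listed in nondecreasing order with multiplicity. Numbering
starts at `0`: `w j` and `lam j` are `w_{j+1}` and `λ_{j+1}` in the usual numbering. The equation
`A w = lam w` is read as `(∇w, ∇φ) = lam (w, φ)` for all `φ ∈ V`. -/
structure IsStokesBasis (w : ℕ → V Ω) (lam : ℕ → ℝ) : Prop where
  orthonormal : Orthonormal ℝ (fun j => fld (w j))
  complete : H Ω ≤ (Submodule.span ℝ (range fun j => fld (w j))).topologicalClosure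
  eigen : ∀ j, ∀ φ : V Ω, inner ℝ (grad (w j)) (grad φ) = lam j * inner ℝ (fld (w j)) (fld φ)
  mono : Monotone lam

/-- `H_m`: the span of the first `m` eigenfunctions. -/
def modes (w : ℕ → V Ω) (m : ℕ) : Submodule ℝ (L2Vec Ω) :=
  Submodule.span ℝ (range fun j : Fin m => fld (w j))

instance (w : ℕ → V Ω) (m : ℕ) : FiniteDimensional ℝ (modes w m) :=
  FiniteDimensional.span_of_finite ℝ (finite_range _)

/-- `P_m`: the `L²`-orthogonal projection onto `H_m`. -/
def modeProj (w : ℕ → V Ω) (m : ℕ) : L2Vec Ω →L[ℝ] L2Vec Ω := (modes w m).starProjection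

/-- `d₁ = ½ min {1/α², λ₁}`. -/
def d1 (α lam1 : ℝ) : ℝ := 1 / 2 * min (1 / α ^ 2) lam1

end NSV

end

/-! ### Sobolev embedding and Ladyzhenskaya's inequality -/

namespace NSV
open scoped ENNReal NNReal

/-! Put z = v - u and let E = ‖z‖² + α²‖∇z‖² be its Voight energy. Testing the difference of the two
equations with z, and using b(u,z,z) = 0 (`trilin_self`), leaves E'/2 = ⟨h - g, z⟩ - ν‖∇z‖² -
b(z,v,z). Only the gradient of v enters the nonlinear term, so an a priori bound is needed for one
solution only.

That bound is the absorbing ball (`eventually_energy_le`): the energy of v eventually lies below any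
L > 𝐡²/(ν²d₁), hence ‖∇v‖² ≤ L/α². With Ladyzhenskaya's inequality, whose constant S³ comes from the
Sobolev inequality on ℝ³ and so does not see Ω, b(z,v,z)⁴ ≤ S⁶ (L²/α⁴) ‖z‖² ‖∇z‖⁶. The spectral gap
replaces ‖z‖² by ‖P_m z‖² + ‖∇z‖²/λ_{m+1} (`norm_fld_sq_le`). Without the P_m term, viscosity beats
the nonlinearity exactly when S⁶L²/α⁴ < ν⁴λ_{m+1}, which for L near 𝐡²/(ν²d₁) is the assumption on
λ_{m+1}. Strictness leaves room to split off the P_m part (`exists_bound_of_pow_four_le`):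
|b(z,v,z)| ≤ ρ‖∇z‖² + D‖P_m z‖² with ρ < ν.

Since d₁E ≤ ‖∇z‖², this yields E' ≤ -(ν-ρ)d₁E + F with F → 0, and a Gronwall argument gives E → 0.
-/

theorem norm_fderiv_le_norm_gradField (φ : E3 → E3) (x : E3) :
    ‖fderiv ℝ φ x‖ ≤ ‖gradField φ x‖ := by
  refine ContinuousLinearMap.opNorm_le_bound _ (norm_nonneg _) fun v => ?_
  have hv : v = ∑ i, v i • EuclideanSpace.single i (1 : ℝ) := by
    ext j; simp [Finset.sum_apply, Pi.single_apply]
  have h1 : fderiv ℝ φ x v = ∑ i, v i • gradField φ x i := by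
    conv_lhs => rw [hv]
    simp only [map_sum, map_smul]
    rfl
  rw [h1]
  calc ‖∑ i, v i • gradField φ x i‖ ≤ ∑ i, ‖v i‖ * ‖gradField φ x i‖ := by
        refine (norm_sum_le _ _).trans_eq ?_
        simp [norm_smul]
    _ ≤ √(∑ i, ‖v i‖ ^ 2) * √(∑ i, ‖gradField φ x i‖ ^ 2) :=
        Real.sum_mul_le_sqrt_mul_sqrt _ _ _
    _ = ‖gradField φ x‖ * ‖v‖ := by
        rw [EuclideanSpace.norm_eq, PiLp.norm_eq_of_L2, mul_comm]

theorem gradField_eq_zero_of_notMem {Ω : Set E3} {φ : E3 → E3} (hφ : IsTestField Ω φ) {x : E3}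
    (hx : x ∉ Ω) : gradField φ x = 0 := by
  have h0 : fderiv ℝ φ x = 0 := by
    by_contra h
    exact hx (hφ.support (support_fderiv_subset ℝ h))
  ext i j
  simp [gradField, h0]

/-- The constant of the Sobolev embedding `H¹₀ ⊂ L⁶` in dimension three. -/
noncomputable def sobolevConst : ℝ≥0 := SNormLESNormFDerivOfEqConst E3 (volume : Measure E3) 2

/-- The Sobolev inequality is applied on all of ℝ³ to the extension by zero, which makes the
constant independent of `Ω`; the gradient vanishes off `Ω`, so restricting its norm loses nothing.
-/
theorem IsTestField.eLpNorm_six_le {Ω : Set E3} {φ : E3 → E3} (hφ : IsTestField Ω φ) :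
    eLpNorm φ 6 (volume.restrict Ω) ≤
      sobolevConst * eLpNorm (gradField φ) 2 (volume.restrict Ω) := by
  have h1 : eLpNorm φ (6 : ℝ≥0) volume ≤ sobolevConst * eLpNorm (fderiv ℝ φ) (2 : ℝ≥0) volume := by
    refine eLpNorm_le_eLpNorm_fderiv_of_eq (F := E3) volume (hφ.smooth.of_le (by simp)) hφ.compact
      (p := 2) (p' := 6) (by norm_num) ?_ ?_
    · simp
    · simp; norm_num
  have h2 : eLpNorm (gradField φ) 2 (volume.restrict Ω) = eLpNorm (gradField φ) 2 volume :=
    eLpNorm_restrict_eq_of_support_subset fun x hx => by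
      by_contra h
      exact hx (gradField_eq_zero_of_notMem hφ h)
  rw [h2]
  refine (eLpNorm_mono_measure _ Measure.restrict_le_self).trans (h1.trans ?_)
  gcongr
  exact eLpNorm_mono fun x => norm_fderiv_le_norm_gradField φ x

theorem eLpNorm_six_le {Ω : Set E3} {p : L2Vec Ω × L2Grad Ω} (hp : p ∈ H10 Ω) :
    eLpNorm p.1 6 (volume.restrict Ω) ≤ sobolevConst * ‖p.2‖ₑ := by
  obtain ⟨q, hq, hlim⟩ := mem_closure_iff_seq_limit.1
    (show p ∈ closure (testGraph Ω : Set (L2Vec Ω × L2Grad Ω)) from hp)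
  have hb : ∀ n, eLpNorm (q n).1 6 (volume.restrict Ω) ≤ sobolevConst * ‖(q n).2‖ₑ := by
    intro n
    obtain ⟨φ, hφ, e1, e2⟩ := hq n
    rw [eLpNorm_congr_ae e1, Lp.enorm_def, eLpNorm_congr_ae e2]
    exact hφ.eLpNorm_six_le
  have h1 : Tendsto (fun n => (q n).1) atTop (𝓝 p.1) := hlim.fst_nhds
  have h2 : Tendsto (fun n => (q n).2) atTop (𝓝 p.2) := hlim.snd_nhds
  -- Approximants converge in L² but not a priori in L⁶; an a.e. convergent subsequence and Fatou
  -- suffice.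
  obtain ⟨ns, hns, hae⟩ := (tendstoInMeasure_of_tendsto_Lp h1).exists_seq_tendsto_ae
  refine (Lp.eLpNorm_lim_le_liminf_eLpNorm (fun n => Lp.aestronglyMeasurable (q (ns n)).1) _
    hae).trans ?_
  have h3 : Tendsto (fun n => (sobolevConst : ℝ≥0∞) * ‖(q (ns n)).2‖ₑ) atTop
      (𝓝 (sobolevConst * ‖p.2‖ₑ)) :=
    ENNReal.Tendsto.const_mul ((continuous_enorm.tendsto _).comp (h2.comp hns.tendsto_atTop))
      (Or.inr ENNReal.coe_ne_top)
  rw [← h3.liminf_eq]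
  exact liminf_le_liminf (Eventually.of_forall fun n => hb (ns n))

instance : ENNReal.HolderTriple 8 8 4 where
  inv_add_inv_eq_inv := by
    have h8 : (8 : ℝ≥0∞)⁻¹ = 2⁻¹ * 4⁻¹ := by
      rw [← ENNReal.mul_inv (by simp) (by simp)]; norm_num
    rw [h8, ← add_mul, ENNReal.inv_two_add_inv_two, one_mul]

instance : ENNReal.HolderTriple 4 4 2 where
  inv_add_inv_eq_inv := by
    have h8 : (4 : ℝ≥0∞)⁻¹ = 2⁻¹ * 2⁻¹ := by
      rw [← ENNReal.mul_inv (by simp) (by simp)]; norm_num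
    rw [h8, ← add_mul, ENNReal.inv_two_add_inv_two, one_mul]

/-- Hölder with exponents 8, 8 on |f| = |f|^(1/4) |f|^(3/4): the factors have L⁸ norms ‖f‖₂^(1/4)
and ‖f‖₆^(3/4). -/
theorem eLpNorm_four_le_interpolate {α F : Type*} [MeasurableSpace α] {μ : Measure α}
    [NormedAddCommGroup F] {f : α → F} (hf : AEStronglyMeasurable f μ) :
    eLpNorm f 4 μ ≤ eLpNorm f 2 μ ^ (1 / 4 : ℝ) * eLpNorm f 6 μ ^ (3 / 4 : ℝ) := by
  have h := eLpNorm_le_eLpNorm_mul_eLpNorm'_of_norm (μ := μ) (p := 8) (q := 8) (r := 4)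
    (f := fun x => ‖f x‖ ^ (1 / 4 : ℝ)) (g := fun x => ‖f x‖ ^ (3 / 4 : ℝ))
    (hf.norm.aemeasurable.pow_const _).aestronglyMeasurable
    (hf.norm.aemeasurable.pow_const _).aestronglyMeasurable (fun a b => a * b) 1
    (Eventually.of_forall fun x => by simp)
  have e1 : eLpNorm (fun x => ‖f x‖ ^ (1 / 4 : ℝ)) 8 μ = eLpNorm f 2 μ ^ (1 / 4 : ℝ) := by
    rw [eLpNorm_norm_rpow f (by norm_num)]
    congr 2
    rw [show (8 : ℝ≥0∞) = ENNReal.ofReal 8 by simp, ← ENNReal.ofReal_mul (by norm_num)]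
    norm_num
  have e2 : eLpNorm (fun x => ‖f x‖ ^ (3 / 4 : ℝ)) 8 μ = eLpNorm f 6 μ ^ (3 / 4 : ℝ) := by
    rw [eLpNorm_norm_rpow f (by norm_num)]
    congr 2
    rw [show (8 : ℝ≥0∞) = ENNReal.ofReal 8 by simp, ← ENNReal.ofReal_mul (by norm_num)]
    norm_num
  have e3 : eLpNorm (fun x => ‖f x‖ ^ (1 / 4 : ℝ) * ‖f x‖ ^ (3 / 4 : ℝ)) 4 μ = eLpNorm f 4 μ := by
    rw [← eLpNorm_norm f]
    congr 1
    funext x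
    rw [← Real.rpow_add_of_nonneg (norm_nonneg _) (by norm_num) (by norm_num)]
    norm_num
  rw [e1, e2, e3] at h
  simpa using h

/-- The `L⁴` norm of a field. -/
noncomputable def norm4 {Ω : Set E3} (u : L2Vec Ω) : ℝ := (eLpNorm u 4 (volume.restrict Ω)).toReal

theorem norm4_nonneg {Ω : Set E3} (u : L2Vec Ω) : 0 ≤ norm4 u := ENNReal.toReal_nonneg

theorem eLpNorm_four_le {Ω : Set E3} {p : L2Vec Ω × L2Grad Ω} (hp : p ∈ H10 Ω) :
    eLpNorm p.1 4 (volume.restrict Ω) ≤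
      ‖p.1‖ₑ ^ (1 / 4 : ℝ) * (sobolevConst * ‖p.2‖ₑ) ^ (3 / 4 : ℝ) := by
  refine (eLpNorm_four_le_interpolate (Lp.aestronglyMeasurable p.1)).trans ?_
  rw [← Lp.enorm_def]
  gcongr
  exact eLpNorm_six_le hp

theorem memLp_four {Ω : Set E3} {p : L2Vec Ω × L2Grad Ω} (hp : p ∈ H10 Ω) :
    MemLp p.1 4 (volume.restrict Ω) := by
  refine ⟨Lp.aestronglyMeasurable _, (eLpNorm_four_le hp).trans_lt ?_⟩
  refine ENNReal.mul_lt_top ?_ ?_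
  · exact ENNReal.rpow_lt_top_of_nonneg (by norm_num) (by simp)
  · exact ENNReal.rpow_lt_top_of_nonneg (by norm_num) (ENNReal.mul_ne_top (by simp) (by simp))

/-- Ladyzhenskaya's inequality in dimension three. -/
theorem norm4_pow_four_le {Ω : Set E3} {p : L2Vec Ω × L2Grad Ω} (hp : p ∈ H10 Ω) :
    norm4 p.1 ^ 4 ≤ (sobolevConst : ℝ) ^ 3 * (‖p.1‖ * ‖p.2‖ ^ 3) := by
  have h1 : norm4 p.1 ≤ ‖p.1‖ ^ (1 / 4 : ℝ) * (sobolevConst * ‖p.2‖) ^ (3 / 4 : ℝ) := by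
    have h := ENNReal.toReal_mono (ENNReal.mul_ne_top
      (ENNReal.rpow_ne_top_of_nonneg (by norm_num) (by simp))
      (ENNReal.rpow_ne_top_of_nonneg (by norm_num) (ENNReal.mul_ne_top (by simp) (by simp))))
      (eLpNorm_four_le hp)
    simpa only [ENNReal.toReal_mul, ← ENNReal.toReal_rpow, toReal_enorm, ENNReal.coe_toReal,
      norm4] using h
  refine (pow_le_pow_left₀ (norm4_nonneg _) h1 4).trans_eq ?_
  rw [mul_pow, ← Real.rpow_natCast, ← Real.rpow_natCast, ← Real.rpow_mul (by positivity),
    ← Real.rpow_mul (by positivity)]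
  norm_num
  ring

end NSV

/-! ### The trilinear form and its cancellation -/

namespace NSV
open scoped ENNReal NNReal

variable {Ω : Set E3}

/-- The integrand of the trilinear form, on vectors. -/
noncomputable def trilinPt (a : E3) (F : Grad3) (b : E3) : ℝ := ∑ i : Fin 3, a i * inner ℝ (F i) b

theorem abs_trilinPt_le (a : E3) (F : Grad3) (b : E3) : |trilinPt a F b| ≤ ‖F‖ * (‖a‖ * ‖b‖) := by
  calc |trilinPt a F b| ≤ ∑ i, ‖a i‖ * (‖F i‖ * ‖b‖) := by
        refine (Finset.abs_sum_le_sum_abs _ _).trans (Finset.sum_le_sum fun i _ => ?_)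
        rw [abs_mul]
        exact mul_le_mul_of_nonneg_left (abs_real_inner_le_norm _ _) (abs_nonneg _)
    _ = (∑ i, ‖a i‖ * ‖F i‖) * ‖b‖ := by rw [Finset.sum_mul]; simp only [mul_assoc]
    _ ≤ (√(∑ i, ‖a i‖ ^ 2) * √(∑ i, ‖F i‖ ^ 2)) * ‖b‖ := by
        gcongr
        exact Real.sum_mul_le_sqrt_mul_sqrt _ _ _
    _ = ‖F‖ * (‖a‖ * ‖b‖) := by
        rw [EuclideanSpace.norm_eq a, PiLp.norm_eq_of_L2 F]; ring

theorem continuous_trilinPt :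
    Continuous fun p : (E3 × Grad3) × E3 => trilinPt p.1.1 p.1.2 p.2 := by
  unfold trilinPt
  fun_prop

/-- The trilinear form on independent fields and gradients. -/
noncomputable def trilinForm (u : L2Vec Ω) (F : L2Grad Ω) (w : L2Vec Ω) : ℝ :=
  ∫ x in Ω, trilinPt (u x) (F x) (w x)

theorem trilin_eq (u v w : V Ω) : trilin u v w = trilinForm (fld u) (grad v) (fld w) := rfl

theorem aestronglyMeasurable_trilinPt (u : L2Vec Ω) (F : L2Grad Ω) (w : L2Vec Ω) :
    AEStronglyMeasurable (fun x => trilinPt (u x) (F x) (w x)) (volume.restrict Ω) :=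
  continuous_trilinPt.comp_aestronglyMeasurable
    (((Lp.aestronglyMeasurable u).prodMk (Lp.aestronglyMeasurable F)).prodMk
      (Lp.aestronglyMeasurable w))

/-- Hölder twice: 1/4 + 1/4 = 1/2 for the two fields, then 1/2 + 1/2 = 1 with the gradient. -/
theorem eLpNorm_trilinPt_le (u : L2Vec Ω) (F : L2Grad Ω) (w : L2Vec Ω) :
    eLpNorm (fun x => trilinPt (u x) (F x) (w x)) 1 (volume.restrict Ω) ≤
      ‖F‖ₑ * (eLpNorm u 4 (volume.restrict Ω) * eLpNorm w 4 (volume.restrict Ω)) := by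
  have hu := (Lp.aestronglyMeasurable u).norm
  have hF := (Lp.aestronglyMeasurable F).norm
  have hw := (Lp.aestronglyMeasurable w).norm
  have h1 := eLpNorm_le_eLpNorm_mul_eLpNorm'_of_norm (p := 4) (q := 4) (r := 2) hu hw
    (fun a b => a * b) 1 (Eventually.of_forall fun x => by simp)
  have h2 := eLpNorm_le_eLpNorm_mul_eLpNorm'_of_norm (p := 2) (q := 2) (r := 1) hF (hu.mul hw)
    (fun a b => a * b) 1 (Eventually.of_forall fun x => by simp)
  simp only [eLpNorm_norm, ENNReal.coe_one, one_mul] at h1 h2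
  refine le_trans (eLpNorm_mono fun x => ?_) (h2.trans ?_)
  · simpa [abs_mul] using abs_trilinPt_le (u x) (F x) (w x)
  · rw [Lp.enorm_def]
    exact mul_le_mul_right h1 _

theorem integrable_trilinPt {u w : L2Vec Ω} (hu : MemLp u 4 (volume.restrict Ω)) (F : L2Grad Ω)
    (hw : MemLp w 4 (volume.restrict Ω)) :
    Integrable (fun x => trilinPt (u x) (F x) (w x)) (volume.restrict Ω) := by
  rw [← memLp_one_iff_integrable]
  refine ⟨aestronglyMeasurable_trilinPt u F w, (eLpNorm_trilinPt_le u F w).trans_lt ?_⟩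
  exact ENNReal.mul_lt_top (by simp) (ENNReal.mul_lt_top hu.2 hw.2)

theorem abs_trilinForm_le {u w : L2Vec Ω} (hu : MemLp u 4 (volume.restrict Ω)) (F : L2Grad Ω)
    (hw : MemLp w 4 (volume.restrict Ω)) :
    |trilinForm u F w| ≤ ‖F‖ * (norm4 u * norm4 w) := by
  have h1 : ‖trilinForm u F w‖ₑ ≤
      ‖F‖ₑ * (eLpNorm u 4 (volume.restrict Ω) * eLpNorm w 4 (volume.restrict Ω)) := by
    refine (enorm_integral_le_lintegral_enorm _).trans ?_
    rw [← eLpNorm_one_eq_lintegral_enorm]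
    exact eLpNorm_trilinPt_le u F w
  have h2 := ENNReal.toReal_mono (ENNReal.mul_ne_top (by simp)
    (ENNReal.mul_ne_top hu.2.ne hw.2.ne)) h1
  simpa only [ENNReal.toReal_mul, toReal_enorm, Real.norm_eq_abs, norm4] using h2

theorem trilinForm_sub_left {u u' w : L2Vec Ω} (hu : MemLp u 4 (volume.restrict Ω))
    (hu' : MemLp u' 4 (volume.restrict Ω)) (F : L2Grad Ω) (hw : MemLp w 4 (volume.restrict Ω)) :
    trilinForm (u - u') F w = trilinForm u F w - trilinForm u' F w := by
  unfold trilinForm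
  rw [← integral_sub (integrable_trilinPt hu F hw) (integrable_trilinPt hu' F hw)]
  refine integral_congr_ae ?_
  filter_upwards [Lp.coeFn_sub u u'] with x hx
  rw [hx]
  simp [trilinPt, sub_mul, Finset.sum_sub_distrib]

theorem trilinForm_sub_middle {u w : L2Vec Ω} (hu : MemLp u 4 (volume.restrict Ω))
    (F G : L2Grad Ω) (hw : MemLp w 4 (volume.restrict Ω)) :
    trilinForm u (F - G) w = trilinForm u F w - trilinForm u G w := by
  unfold trilinForm
  rw [← integral_sub (integrable_trilinPt hu F hw) (integrable_trilinPt hu G hw)]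
  refine integral_congr_ae ?_
  filter_upwards [Lp.coeFn_sub F G] with x hx
  rw [hx]
  simp [trilinPt, inner_sub_left, mul_sub, Finset.sum_sub_distrib]

theorem trilinForm_sub_right {u w w' : L2Vec Ω} (hu : MemLp u 4 (volume.restrict Ω))
    (F : L2Grad Ω) (hw : MemLp w 4 (volume.restrict Ω)) (hw' : MemLp w' 4 (volume.restrict Ω)) :
    trilinForm u F (w - w') = trilinForm u F w - trilinForm u F w' := by
  unfold trilinForm
  rw [← integral_sub (integrable_trilinPt hu F hw) (integrable_trilinPt hu F hw')]
  refine integral_congr_ae ?_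
  filter_upwards [Lp.coeFn_sub w w'] with x hx
  rw [hx]
  simp [trilinPt, inner_sub_right, mul_sub, Finset.sum_sub_distrib]

/-- Half of the gradient of `|φ|²`. -/
noncomputable def halfGradNormSq (φ : E3 → E3) (x : E3) : E3 :=
  WithLp.toLp 2 fun i => inner ℝ (gradField φ x i) (φ x)

theorem inner_halfGradNormSq (φ : E3 → E3) (x a : E3) :
    inner ℝ (halfGradNormSq φ x) a = trilinPt a (gradField φ x) (φ x) := by
  simp [halfGradNormSq, trilinPt, PiLp.inner_apply]

theorem IsTestField.continuous_gradField {φ : E3 → E3} (hφ : IsTestField Ω φ) :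
    Continuous (gradField φ) := by
  have h := hφ.smooth.continuous_fderiv (by simp)
  unfold gradField
  fun_prop

theorem IsTestField.memLp_halfGradNormSq {φ : E3 → E3} (hφ : IsTestField Ω φ) :
    MemLp (halfGradNormSq φ) 2 (volume.restrict Ω) := by
  have hc : Continuous (halfGradNormSq φ) := by
    have h1 := hφ.continuous_gradField
    have h2 := hφ.smooth.continuous
    have h3 : ∀ i, Continuous fun x => gradField φ x i := fun i =>
      (PiLp.continuous_apply 2 _ i).comp h1
    exact (PiLp.continuous_toLp 2 _).comp (continuous_pi fun i => (h3 i).inner h2)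
  refine MemLp.restrict _ (hc.memLp_of_hasCompactSupport (hφ.compact.mono' fun x hx => ?_))
  refine subset_tsupport φ fun h => hx ?_
  ext i
  simp [halfGradNormSq, h]

/-- Integration by parts moves the derivatives onto `η`, where they add up to its divergence.
Compact support of `η` alone removes the boundary terms. -/
theorem integral_sum_mul_fderiv_eq_zero {η : E3 → E3} (hη : IsTestField Ω η)
    (hdiv : divField η = 0) {g : E3 → ℝ} (hg : ContDiff ℝ ∞ g) :
    ∫ x, ∑ i, η x i * fderiv ℝ g x (EuclideanSpace.single i 1) = 0 := by
  have hηi : ∀ i, ContDiff ℝ ∞ fun x => η x i := fun i =>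
    (EuclideanSpace.proj i : E3 →L[ℝ] ℝ).contDiff.comp hη.smooth
  have hηd : ∀ i x v, fderiv ℝ (fun x => η x i) x v = fderiv ℝ η x v i := by
    intro i x v
    have h1 := ((EuclideanSpace.proj i : E3 →L[ℝ] ℝ).hasFDerivAt.comp x
      (hη.differentiable x).hasFDerivAt).fderiv
    exact congrArg (fun L : E3 →L[ℝ] ℝ => L v) h1
  have hηc : ∀ i, HasCompactSupport fun x => η x i := fun i =>
    hη.compact.comp_left (g := fun a : E3 => a i) rfl
  have hηdc : ∀ i v, Continuous fun x => fderiv ℝ (fun x => η x i) x v := fun i v =>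
    ((hηi i).continuous_fderiv (by simp)).clm_apply continuous_const
  have hgdc : ∀ v, Continuous fun x => fderiv ℝ g x v := fun v =>
    (hg.continuous_fderiv (by simp)).clm_apply continuous_const
  have hint1 : ∀ i v, Integrable fun x => fderiv ℝ (fun x => η x i) x v * g x := fun i v =>
    ((hηdc i v).mul hg.continuous).integrable_of_hasCompactSupport
      ((hηc i).fderiv_apply ℝ v).mul_right
  have hint2 : ∀ i v, Integrable fun x => η x i * fderiv ℝ g x v := fun i v =>
    ((hηi i).continuous.mul (hgdc v)).integrable_of_hasCompactSupport (hηc i).mul_right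
  have hint3 : ∀ i, Integrable fun x => η x i * g x := fun i =>
    ((hηi i).continuous.mul hg.continuous).integrable_of_hasCompactSupport (hηc i).mul_right
  have hparts : ∀ i v, ∫ x, η x i * fderiv ℝ g x v =
      -∫ x, fderiv ℝ (fun x => η x i) x v * g x := fun i v =>
    integral_mul_fderiv_eq_neg_fderiv_mul_of_integrable (hint1 i v) (hint2 i v) (hint3 i)
      (fun x _ => (hηi i).differentiable (by simp) x)
      (fun x _ => hg.differentiable (by simp) x)
  rw [integral_finsetSum _ fun i _ => hint2 i _]
  simp only [hparts]
  rw [Finset.sum_neg_distrib, ← integral_finsetSum _ fun i _ => hint1 i _, neg_eq_zero]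
  refine (integral_congr_ae (Eventually.of_forall fun x => ?_)).trans (integral_zero E3 ℝ)
  simp only [hηd]
  rw [← Finset.sum_mul, show ∑ i, fderiv ℝ η x (EuclideanSpace.single i 1) i = 0 from
    congrFun hdiv x, zero_mul]

theorem fderiv_half_inner_self {φ : E3 → E3} (hφ : Differentiable ℝ φ) (x v : E3) :
    fderiv ℝ (fun x => 1 / 2 * inner ℝ (φ x) (φ x)) x v = inner ℝ (fderiv ℝ φ x v) (φ x) := by
  have h := (hφ x).hasFDerivAt
  rw [((h.inner ℝ h).const_mul (1 / 2 : ℝ)).fderiv]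
  simp [real_inner_comm]
  ring

theorem setIntegral_trilinPt_test_eq_zero {η φ : E3 → E3} (hη : IsTestField Ω η)
    (hdiv : divField η = 0) (hφ : IsTestField Ω φ) :
    ∫ x in Ω, trilinPt (η x) (gradField φ x) (φ x) = 0 := by
  rw [setIntegral_eq_integral_of_forall_compl_eq_zero fun x hx => by
    simp [trilinPt, gradField_eq_zero_of_notMem hφ hx]]
  rw [← integral_sum_mul_fderiv_eq_zero hη hdiv
    (contDiff_const.mul (hφ.smooth.inner ℝ hφ.smooth) :
      ContDiff ℝ ∞ fun x => 1 / 2 * inner ℝ (φ x) (φ x))]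
  simp only [fderiv_half_inner_self hφ.differentiable]
  rfl

/-- For a fixed test field `φ` the integral is the L² pairing of `u` with ½∇|φ|², hence continuous
in `u`; its vanishing passes from solenoidal test fields to their closure. -/
theorem setIntegral_trilinPt_eq_zero {u : L2Vec Ω} (hu : u ∈ H Ω) {φ : E3 → E3}
    (hφ : IsTestField Ω φ) : ∫ x in Ω, trilinPt (u x) (gradField φ x) (φ x) = 0 := by
  let G : L2Vec Ω := hφ.memLp_halfGradNormSq.toLp _
  have hG : ∀ u : L2Vec Ω, inner ℝ G u = ∫ x in Ω, trilinPt (u x) (gradField φ x) (φ x) := by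
    intro u
    rw [L2.inner_def]
    refine integral_congr_ae ?_
    filter_upwards [hφ.memLp_halfGradNormSq.coeFn_toLp] with x hx
    rw [hx, inner_halfGradNormSq]
  have hcl : IsClosed {u : L2Vec Ω | inner ℝ G u = 0} := isClosed_eq (by fun_prop) continuous_const
  have hsub : (solenoidalTest Ω : Set (L2Vec Ω)) ⊆ {u : L2Vec Ω | inner ℝ G u = 0} := by
    rintro u ⟨η, hη, hdiv, e⟩
    simp only [mem_ofPred_eq]
    rw [hG, ← setIntegral_trilinPt_test_eq_zero hη hdiv hφ]
    refine integral_congr_ae ?_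
    filter_upwards [e] with x hx
    rw [hx]
  rw [← hG]
  exact closure_minimal hsub hcl hu

theorem norm4_le {p : L2Vec Ω × L2Grad Ω} (hp : p ∈ H10 Ω) :
    norm4 p.1 ^ 4 ≤ (sobolevConst : ℝ) ^ 3 * ‖p‖ ^ 4 := by
  refine (norm4_pow_four_le hp).trans ?_
  have h1 : ‖p.1‖ ≤ ‖p‖ := norm_fst_le p
  have h2 : ‖p.2‖ ≤ ‖p‖ := norm_snd_le p
  calc (sobolevConst : ℝ) ^ 3 * (‖p.1‖ * ‖p.2‖ ^ 3)
      ≤ (sobolevConst : ℝ) ^ 3 * (‖p‖ * ‖p‖ ^ 3) := by gcongr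
    _ = _ := by ring

/-- Second density argument, now in the transported field: Ladyzhenskaya's inequality turns H¹
convergence into L⁴ convergence, in which the form is continuous. -/
theorem trilinForm_self_eq_zero {u : L2Vec Ω} (hu : u ∈ H Ω) (hu4 : MemLp u 4 (volume.restrict Ω))
    {p : L2Vec Ω × L2Grad Ω} (hp : p ∈ H10 Ω) : trilinForm u p.2 p.1 = 0 := by
  obtain ⟨q, hq, hlim⟩ := mem_closure_iff_seq_limit.1
    (show p ∈ closure (testGraph Ω : Set (L2Vec Ω × L2Grad Ω)) from hp)
  have hqH : ∀ n, q n ∈ H10 Ω := fun n => Submodule.le_topologicalClosure _ (hq n)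
  have h0 : ∀ n, trilinForm u (q n).2 (q n).1 = 0 := by
    intro n
    obtain ⟨φ, hφ, e1, e2⟩ := hq n
    rw [← setIntegral_trilinPt_eq_zero hu hφ]
    refine integral_congr_ae ?_
    filter_upwards [e1, e2] with x h1 h2
    rw [h1, h2]
  have hsub : Tendsto (fun n => p - q n) atTop (𝓝 0) := by
    simpa using hlim.const_sub p
  have h4 : Tendsto (fun n => norm4 (p - q n).1) atTop (𝓝 0) := by
    have h5 : Tendsto (fun n => (sobolevConst : ℝ) ^ 3 * ‖p - q n‖ ^ 4) atTop (𝓝 0) := by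
      simpa using ((hsub.norm.pow 4).const_mul ((sobolevConst : ℝ) ^ 3))
    have h6 : Tendsto (fun n => norm4 (p - q n).1 ^ 4) atTop (𝓝 0) :=
      squeeze_zero (fun n => by positivity)
        (fun n => norm4_le (Submodule.sub_mem _ hp (hqH n))) h5
    -- Two square roots undo the fourth power.
    have h7 := h6.sqrt.sqrt
    simp only [Real.sqrt_zero] at h7
    refine h7.congr fun n => ?_
    rw [show norm4 (p - q n).1 ^ 4 = (norm4 (p - q n).1 ^ 2) ^ 2 by ring,
      Real.sqrt_sq (by positivity), Real.sqrt_sq (norm4_nonneg _)]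
  have hbound : ∀ n, |trilinForm u p.2 p.1| ≤
      ‖p.2 - (q n).2‖ * (norm4 u * norm4 p.1) + ‖(q n).2‖ * (norm4 u * norm4 (p - q n).1) := by
    intro n
    have hp4 := memLp_four hp
    have hq4 := memLp_four (hqH n)
    have hs4 : MemLp (p.1 - (q n).1 : L2Vec Ω) 4 (volume.restrict Ω) :=
      memLp_four (Submodule.sub_mem _ hp (hqH n))
    have e : trilinForm u p.2 p.1 =
        trilinForm u (p.2 - (q n).2) p.1 + trilinForm u (q n).2 (p.1 - (q n).1) := by
      rw [trilinForm_sub_middle hu4 _ _ hp4, trilinForm_sub_right hu4 _ hp4 hq4, h0 n]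
      ring
    rw [e]
    exact (abs_add_le _ _).trans
      (add_le_add (abs_trilinForm_le hu4 _ hp4) (abs_trilinForm_le hu4 _ hs4))
  have hl : Tendsto (fun n => ‖p.2 - (q n).2‖ * (norm4 u * norm4 p.1) +
      ‖(q n).2‖ * (norm4 u * norm4 (p - q n).1)) atTop (𝓝 0) := by
    have a1 : Tendsto (fun n => ‖p.2 - (q n).2‖) atTop (𝓝 0) := by
      simpa using hsub.snd_nhds.norm
    have a2 := hlim.snd_nhds.norm
    simpa using (a1.mul_const (norm4 u * norm4 p.1)).add (a2.mul (h4.const_mul (norm4 u)))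
  have := ge_of_tendsto' hl hbound
  exact abs_nonpos_iff.1 this

theorem trilin_self (u v : V Ω) : trilin u v v = 0 := by
  rw [trilin_eq]
  exact trilinForm_self_eq_zero u.2.2 (memLp_four u.2.1) v.2.1

theorem trilin_self_sub (v u : V Ω) :
    trilin v v (v - u) - trilin u u (v - u) = trilin (v - u) v (v - u) := by
  have hv := memLp_four v.2.1
  have hu := memLp_four u.2.1
  have hs := memLp_four (v - u).2.1
  have h := trilin_self u (v - u)
  simp only [trilin_eq] at h ⊢
  have e1 : grad (v - u) = grad v - grad u := rfl
  have e2 : trilinForm (fld (v - u)) (grad v) (fld (v - u)) =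
      trilinForm (fld v) (grad v) (fld (v - u)) - trilinForm (fld u) (grad v) (fld (v - u)) :=
    trilinForm_sub_left hv hu _ hs
  have e3 : trilinForm (fld u) (grad v - grad u) (fld (v - u)) =
      trilinForm (fld u) (grad v) (fld (v - u)) - trilinForm (fld u) (grad u) (fld (v - u)) :=
    trilinForm_sub_middle hu (grad v) (grad u) hs
  rw [e1, e3] at h
  rw [e2]
  linarith

/-- Hölder followed by Ladyzhenskaya; fourth powers keep all exponents integral. -/
theorem trilin_pow_four_le (v w : V Ω) :
    trilin w v w ^ 4 ≤
      (sobolevConst : ℝ) ^ 6 * (‖grad v‖ ^ 4 * (‖fld w‖ ^ 2 * ‖grad w‖ ^ 6)) := by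
  have hw := memLp_four w.2.1
  have h1 : |trilin w v w| ≤ ‖grad v‖ * (norm4 (fld w) * norm4 (fld w)) :=
    abs_trilinForm_le hw _ hw
  have h2 : norm4 (fld w) ^ 4 ≤ (sobolevConst : ℝ) ^ 3 * (‖fld w‖ * ‖grad w‖ ^ 3) :=
    norm4_pow_four_le w.2.1
  have h0 := norm4_nonneg (fld w)
  calc trilin w v w ^ 4 = |trilin w v w| ^ 4 := by rw [← abs_pow, abs_of_nonneg (by positivity)]
    _ ≤ (‖grad v‖ * (norm4 (fld w) * norm4 (fld w))) ^ 4 := by gcongr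
    _ = ‖grad v‖ ^ 4 * (norm4 (fld w) ^ 4) ^ 2 := by ring
    _ ≤ ‖grad v‖ ^ 4 * ((sobolevConst : ℝ) ^ 3 * (‖fld w‖ * ‖grad w‖ ^ 3)) ^ 2 := by gcongr
    _ = _ := by ring

/-- Ladyzhenskaya forces the L⁴ norm to vanish. This is what makes the Stokes eigenvalues positive.
-/
theorem fld_eq_zero_of_grad_eq_zero {v : V Ω} (hv : grad v = 0) : fld v = 0 := by
  have h : norm4 (fld v) ^ 4 ≤ (sobolevConst : ℝ) ^ 3 * (‖fld v‖ * ‖grad v‖ ^ 3) :=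
    norm4_pow_four_le v.2.1
  rw [hv, norm_zero] at h
  have h0 : norm4 (fld v) = 0 := by
    have : norm4 (fld v) ^ 4 = 0 := le_antisymm (by simpa using h) (by positivity)
    exact pow_eq_zero_iff (by norm_num) |>.1 this
  have h1 : eLpNorm (fld v) 4 (volume.restrict Ω) = 0 :=
    ((ENNReal.toReal_eq_zero_iff _).1 h0).resolve_right (memLp_four v.2.1).2.ne
  have h2 := (eLpNorm_eq_zero_iff (Lp.aestronglyMeasurable _) (by norm_num)).1 h1
  exact (Lp.eq_zero_iff_ae_eq_zero).2 h2

end NSV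

/-- A vector in the closed span of an orthonormal family has norm bounded by any bound for its
finite coefficient sums. -/
theorem Orthonormal.norm_sq_le_of_sum_inner_sq_le {ι F : Type*} [NormedAddCommGroup F]
    [InnerProductSpace ℝ F] {e : ι → F} (he : Orthonormal ℝ e) {x : F}
    (hx : x ∈ (Submodule.span ℝ (range e)).topologicalClosure) {c : ℝ}
    (hc : ∀ s : Finset ι, ∑ j ∈ s, inner ℝ (e j) x ^ 2 ≤ c) : ‖x‖ ^ 2 ≤ c := by
  have hc0 : 0 ≤ c := by simpa using hc ∅
  -- This closed set contains the span by Cauchy–Schwarz on coefficients, hence contains `x` itself;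
  -- taking y = x gives the bound.
  have hcl : IsClosed {y : F | inner ℝ y x ≤ ‖y‖ * √c} :=
    isClosed_le (by fun_prop) (by fun_prop)
  have hsub : (Submodule.span ℝ (range e) : Set F) ⊆ {y : F | inner ℝ y x ≤ ‖y‖ * √c} := by
    intro y hy
    obtain ⟨l, rfl⟩ := (Finsupp.mem_span_range_iff_exists_finsupp).1 hy
    have h1 : inner ℝ (l.sum fun i a => a • e i) x = ∑ i ∈ l.support, l i * inner ℝ (e i) x := by
      simp [Finsupp.sum, sum_inner, inner_smul_left]
    have h2 : ‖l.sum fun i a => a • e i‖ = √(∑ i ∈ l.support, l i ^ 2) := by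
      rw [← Real.sqrt_sq (norm_nonneg _), ← real_inner_self_eq_norm_sq, Finsupp.sum,
        he.inner_sum]
      simp [sq]
    simp only [mem_ofPred_eq]
    rw [h1, h2]
    refine (Real.sum_mul_le_sqrt_mul_sqrt _ _ _).trans ?_
    gcongr
    exact hc _
  have hxx : inner ℝ x x ≤ ‖x‖ * √c := closure_minimal hsub hcl hx
  rw [real_inner_self_eq_norm_sq] at hxx
  rcases (norm_nonneg x).eq_or_lt with h0 | h0
  · rw [← h0]; simpa using hc0
  · have h3 : ‖x‖ ≤ √c := by nlinarith
    calc ‖x‖ ^ 2 ≤ √c ^ 2 := by gcongr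
      _ = c := Real.sq_sqrt hc0

/-! ### Spectral estimates for the Stokes basis -/

namespace NSV

variable {Ω : Set E3} {w : ℕ → V Ω} {lam : ℕ → ℝ}

theorem IsStokesBasis.norm_grad_sq (hw : IsStokesBasis w lam) (j : ℕ) :
    ‖grad (w j)‖ ^ 2 = lam j := by
  rw [← real_inner_self_eq_norm_sq, hw.eigen, real_inner_self_eq_norm_sq, hw.orthonormal.1]
  simp

/-- Bessel's inequality for ∇w_j/√λ_j, which the eigenvalue equation makes orthonormal in the
gradient space. -/
theorem IsStokesBasis.sum_lam_mul_inner_sq_le (hw : IsStokesBasis w lam) (hpos : ∀ j, 0 < lam j)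
    (φ : V Ω) (s : Finset ℕ) :
    ∑ j ∈ s, lam j * inner ℝ (fld (w j)) (fld φ) ^ 2 ≤ ‖grad φ‖ ^ 2 := by
  have ho : Orthonormal ℝ fun j => (√(lam j))⁻¹ • grad (w j) := by
    rw [orthonormal_iff_ite]
    intro i j
    rw [real_inner_smul_left, real_inner_smul_right, hw.eigen, orthonormal_iff_ite.1 hw.orthonormal]
    split_ifs with h
    · subst h
      have h1 := Real.mul_self_sqrt (hpos i).le
      have h2 := (Real.sqrt_pos.2 (hpos i)).ne'
      field_simp
      nlinarith
    · simp
  refine le_of_eq_of_le (Finset.sum_congr rfl fun j _ => ?_)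
    (ho.sum_inner_products_le (grad φ) (s := s))
  rw [real_inner_smul_left, hw.eigen, Real.norm_eq_abs, sq_abs, mul_pow, inv_pow,
    Real.sq_sqrt (hpos j).le]
  have := (hpos j).ne'
  field_simp

/-- Coefficients with j < m are controlled by the projection. Those with j ≥ m satisfy λ_j ≥ `lam
m`, which is λ_{m+1} because numbering starts at 0. -/
theorem IsStokesBasis.norm_fld_sq_le (hw : IsStokesBasis w lam) (hpos : ∀ j, 0 < lam j)
    (m : ℕ) (φ : V Ω) :
    ‖fld φ‖ ^ 2 ≤ ‖modeProj w m (fld φ)‖ ^ 2 + ‖grad φ‖ ^ 2 / lam m := by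
  refine hw.orthonormal.norm_sq_le_of_sum_inner_sq_le (hw.complete φ.2.2) fun s => ?_
  rw [← Finset.sum_filter_add_sum_filter_not s (fun j => j < m)]
  refine add_le_add ?_ ?_
  · refine le_of_eq_of_le (Finset.sum_congr rfl fun j hj => ?_)
      (hw.orthonormal.sum_inner_products_le (modeProj w m (fld φ))
        (s := s.filter fun j => j < m))
    have hj' : fld (w j) ∈ modes w m :=
      Submodule.subset_span ⟨⟨j, (Finset.mem_filter.1 hj).2⟩, rfl⟩
    have h1 : modeProj w m (fld (w j)) = fld (w j) := Submodule.starProjection_eq_self_iff.2 hj'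
    rw [Real.norm_eq_abs, sq_abs, ← h1, modeProj, Submodule.inner_starProjection_left_eq_right]
    rw [← modeProj, h1]
    rfl
  · rw [le_div_iff₀ (hpos m), mul_comm, Finset.mul_sum]
    refine le_trans (Finset.sum_le_sum fun j hj => ?_)
      (hw.sum_lam_mul_inner_sq_le hpos φ (s.filter fun j => ¬ j < m))
    exact mul_le_mul_of_nonneg_right (hw.mono (not_lt.1 (Finset.mem_filter.1 hj).2)) (sq_nonneg _)

theorem IsStokesBasis.poincare (hw : IsStokesBasis w lam) (hpos : ∀ j, 0 < lam j) (φ : V Ω) :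
    lam 0 * ‖fld φ‖ ^ 2 ≤ ‖grad φ‖ ^ 2 := by
  have h0 : modeProj w 0 (fld φ) = 0 := by
    have : modes w 0 = ⊥ := by simp [modes]
    simp [modeProj, this]
  have h := hw.norm_fld_sq_le hpos 0 φ
  rw [h0, norm_zero, zero_pow two_ne_zero, zero_add, le_div_iff₀ (hpos 0)] at h
  linarith

end NSV

/-! ### Absolute continuity and differential inequalities -/

theorem AbsolutelyContinuousOnInterval.of_dist_le {X Y : Type*} [PseudoMetricSpace X]
    [PseudoMetricSpace Y] {f : ℝ → X} {g : ℝ → Y} {a b K : ℝ}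
    (hg : AbsolutelyContinuousOnInterval g a b)
    (h : ∀ x ∈ uIcc a b, ∀ y ∈ uIcc a b, dist (f x) (f y) ≤ K * dist (g x) (g y)) :
    AbsolutelyContinuousOnInterval f a b := by
  have hK : Tendsto (fun E : ℕ × (ℕ → ℝ × ℝ) =>
      K * ∑ i ∈ Finset.range E.1, dist (g (E.2 i).1) (g (E.2 i).2))
      (totalLengthFilter ⊓ 𝓟 (disjWithin a b)) (𝓝 0) := by
    simpa using Tendsto.const_mul K hg
  refine squeeze_zero' (Eventually.of_forall fun _ => Finset.sum_nonneg fun _ _ => dist_nonneg)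
    ?_ hK
  rw [eventually_inf_principal]
  filter_upwards with E hE
  rw [Finset.mul_sum]
  exact Finset.sum_le_sum fun i hi => h _ (hE.1 i hi).1 _ (hE.1 i hi).2

theorem MeasureTheory.LocallyIntegrableOn.intervalIntegrable_of_nonneg {X : Type*}
    [NormedAddCommGroup X] {f : ℝ → X}
    (hf : LocallyIntegrableOn f (Ici 0)) {a b : ℝ} (ha : 0 ≤ a) (hb : 0 ≤ b) :
    IntervalIntegrable f volume a b := by
  rw [intervalIntegrable_iff]
  refine (hf.integrableOn_compact_subset (t := uIcc a b) (fun x hx => ?_)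
    isCompact_uIcc).mono_set uIoc_subset_uIcc
  exact (le_min ha hb).trans hx.1

section Primitive

variable {X : Type*} [NormedAddCommGroup X] [NormedSpace ℝ X]
  {f v : ℝ → X} {v₀ : X}

theorem primitive_sub (hf : LocallyIntegrableOn f (Ici 0))
    (hv : ∀ t, 0 ≤ t → v t = v₀ + ∫ s in (0 : ℝ)..t, f s) {a b : ℝ} (ha : 0 ≤ a) (hb : 0 ≤ b) :
    v b - v a = ∫ s in a..b, f s := by
  rw [hv a ha, hv b hb, add_sub_add_left_eq_sub]
  exact intervalIntegral.integral_interval_sub_left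
    (hf.intervalIntegrable_of_nonneg le_rfl hb) (hf.intervalIntegrable_of_nonneg le_rfl ha)

/-- Increments of `v` are dominated by those of the real primitive of ‖f‖. -/
theorem primitive_absolutelyContinuous (hf : LocallyIntegrableOn f (Ici 0))
    (hv : ∀ t, 0 ≤ t → v t = v₀ + ∫ s in (0 : ℝ)..t, f s) {a b : ℝ} (ha : 0 ≤ a) (hb : 0 ≤ b) :
    AbsolutelyContinuousOnInterval v a b := by
  have hn := (hf.intervalIntegrable_of_nonneg ha hb).norm
  refine (hn.absolutelyContinuousOnInterval_intervalIntegral (c := a) (by simp)).of_dist_le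
    (K := 1) fun x hx y hy => ?_
  have hx0 : 0 ≤ x := (le_min ha hb).trans hx.1
  have hy0 : 0 ≤ y := (le_min ha hb).trans hy.1
  rw [one_mul, dist_eq_norm, dist_eq_norm, primitive_sub hf hv hy0 hx0,
    intervalIntegral.integral_interval_sub_left
      (hf.intervalIntegrable_of_nonneg ha hx0).norm (hf.intervalIntegrable_of_nonneg ha hy0).norm,
    Real.norm_eq_abs]
  exact intervalIntegral.norm_integral_le_abs_integral_norm

theorem primitive_ae_hasDerivAt [CompleteSpace X] (hf : LocallyIntegrableOn f (Ici 0))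
    (hv : ∀ t, 0 ≤ t → v t = v₀ + ∫ s in (0 : ℝ)..t, f s) :
    ∀ᵐ t ∂(volume.restrict (Ici (0 : ℝ))), HasDerivAt v (f t) t := by
  have h1 : ∀ᵐ t : ℝ, ∀ n : ℕ, t ∈ uIcc (0 : ℝ) n → ∀ c ∈ uIcc (0 : ℝ) n,
      HasDerivAt (fun x => ∫ s in c..x, f s) (f t) t :=
    ae_all_iff.2 fun n => (hf.intervalIntegrable_of_nonneg le_rfl
      (Nat.cast_nonneg n)).ae_hasDerivAt_integral
  -- The formula for `v` holds only on [0,∞), so a two-sided derivative needs t > 0.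
  have h0 : ∀ᵐ t : ℝ, t ≠ 0 := by simp [ae_iff, measure_singleton]
  rw [ae_restrict_iff' measurableSet_Ici]
  filter_upwards [h1, h0] with t ht ht0 htp
  obtain ⟨n, hn⟩ := exists_nat_ge t
  have htpos : 0 < t := lt_of_le_of_ne htp (Ne.symm ht0)
  have h2 := (ht n (by rw [uIcc_of_le (Nat.cast_nonneg n)]; exact ⟨htp, hn⟩) 0 (by simp)).const_add v₀
  refine h2.congr_of_eventuallyEq ?_
  filter_upwards [Ioi_mem_nhds htpos] with s hs using hv s (le_of_lt hs)

theorem AbsolutelyContinuousOnInterval.bilin_self {a b : ℝ}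
    (hv : AbsolutelyContinuousOnInterval v a b) (B : X →L[ℝ] X →L[ℝ] ℝ) :
    AbsolutelyContinuousOnInterval (fun t => B (v t) (v t)) a b := by
  obtain ⟨R, hR⟩ := hv.exists_bound
  refine hv.of_dist_le (K := ‖B‖ * R + ‖B‖ * R) fun x hx y hy => ?_
  have e : B (v x) (v x) - B (v y) (v y) = B (v x - v y) (v x) + B (v y) (v x - v y) := by
    simp
  rw [dist_eq_norm, dist_eq_norm, e]
  have h1 := (B.le_opNorm₂ (v x - v y) (v x)).trans
    (mul_le_mul_of_nonneg_left (hR x hx) (by positivity))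
  have h2 := (B.le_opNorm₂ (v y) (v x - v y)).trans
    (mul_le_mul_of_nonneg_right (mul_le_mul_of_nonneg_left (hR y hy) (norm_nonneg B))
      (norm_nonneg _))
  refine (norm_add_le _ _).trans ((add_le_add h1 h2).trans_eq ?_)
  ring

theorem HasDerivAt.bilin_self {B : X →L[ℝ] X →L[ℝ] ℝ} (hB : ∀ x y, B x y = B y x) {v' : X} {t : ℝ}
    (hv : HasDerivAt v v' t) : HasDerivAt (fun t => B (v t) (v t)) (2 * B v' (v t)) t := by
  have h := (B.hasFDerivAt.comp_hasDerivAt t hv).clm_apply hv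
  have e : 2 * B v' (v t) = B v' (v t) + B (v t) v' := by
    rw [hB (v t)]; ring
  rw [e]
  exact h

end Primitive

/-- A linear differential inequality `E' ≤ -c E + κ` that holds almost everywhere from some time on
eventually keeps a locally absolutely continuous function below every level above `κ / c`. -/
theorem eventually_le_of_ae_deriv_le {E : ℝ → ℝ} {c κ L T : ℝ} (hc : 0 < c)
    (hE : ∀ a b, 0 ≤ a → 0 ≤ b → AbsolutelyContinuousOnInterval E a b)
    (hT0 : 0 ≤ T) (hd : ∀ᵐ t ∂(volume.restrict (Ici (0 : ℝ))), T ≤ t →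
      ∃ d, HasDerivAt E d t ∧ d ≤ -c * E t + κ) (hL : κ / c < L) : ∀ᶠ t in atTop, E t ≤ L := by
  -- Integrating factor: φ' = e^(ct)(E' + cE - κ) ≤ 0 almost everywhere, and absolute continuity
  -- turns this into φ(t) ≤ φ(T).
  let φ : ℝ → ℝ := fun t => Real.exp (c * t) * (E t - κ / c)
  have hmono : ∀ t, T ≤ t → φ t ≤ φ T := by
    intro t ht
    have hac : AbsolutelyContinuousOnInterval φ T t := by
      have h1 : AbsolutelyContinuousOnInterval (fun t => Real.exp (c * t)) T t :=
        ContDiffOn.absolutelyContinuousOnInterval (by fun_prop)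
      have h2 : AbsolutelyContinuousOnInterval (fun _ : ℝ => κ / c) T t :=
        ContDiffOn.absolutelyContinuousOnInterval (by fun_prop)
      exact h1.fun_mul ((hE T t hT0 (hT0.trans ht)).fun_sub h2)
    have h3 := hac.integral_deriv_eq_sub
    have h4 : 0 ≤ ∫ x in T..t, -deriv φ x := by
      refine intervalIntegral.integral_nonneg_of_ae_restrict ht ?_
      have h5 : ∀ᵐ x ∂(volume.restrict (Icc T t)), T ≤ x →
          ∃ d, HasDerivAt E d x ∧ d ≤ -c * E x + κ :=
        ae_restrict_of_ae_restrict_of_subset (fun x hx => hT0.trans hx.1) hd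
      filter_upwards [h5, ae_restrict_mem measurableSet_Icc] with x hdx hx
      obtain ⟨d, hd1, hd2⟩ := hdx hx.1
      have h6 : HasDerivAt φ (Real.exp (c * x) * c * (E x - κ / c) + Real.exp (c * x) * d) x := by
        have h7 : HasDerivAt (fun t => Real.exp (c * t)) (Real.exp (c * x) * c) x := by
          simpa using ((hasDerivAt_id x).const_mul c).exp
        exact h7.mul (hd1.sub_const _)
      have h8 : Real.exp (c * x) * c * (E x - κ / c) + Real.exp (c * x) * d
          = Real.exp (c * x) * (c * E x - κ + d) := by
        field_simp
      have h9 : c * E x - κ + d ≤ 0 := by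
        linarith
      rw [h6.deriv, h8]
      have := mul_nonpos_of_nonneg_of_nonpos (Real.exp_pos (c * x)).le h9
      simpa using this
    rw [intervalIntegral.integral_neg, h3] at h4
    linarith
  have hlim : Tendsto (fun t => κ / c + φ T * Real.exp (-(c * t))) atTop (𝓝 (κ / c + φ T * 0)) := by
    refine (Tendsto.const_mul _ ?_).const_add _
    exact Real.tendsto_exp_neg_atTop_nhds_zero.comp (tendsto_id.const_mul_atTop hc)
  rw [mul_zero, add_zero] at hlim
  filter_upwards [hlim.eventually_lt_const hL, eventually_ge_atTop T] with t h1 h2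
  refine le_trans ?_ h1.le
  have h3 := mul_le_mul_of_nonneg_right (hmono t h2) (Real.exp_pos (-(c * t))).le
  have h4 : φ t * Real.exp (-(c * t)) = E t - κ / c := by
    simp only [φ]
    rw [mul_right_comm, ← Real.exp_add]
    simp
  rw [h4] at h3
  linarith

/-- Here b, p, y stand for b(z,v,z), ‖P_m z‖, ‖∇z‖. If p² ≤ ηy², the bound is a multiple of y² whose
coefficient tends to (κ/l)^(1/4) < ν as η → 0; otherwise y² ≤ p²/η and everything is absorbed into
p². -/
theorem exists_bound_of_pow_four_le {κ ν l : ℝ} (hκ : 0 ≤ κ) (hν : 0 < ν) (hl : 0 < l)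
    (h : κ < ν ^ 4 * l) : ∃ ρ < ν, ∃ D, 0 ≤ D ∧ ∀ b p y : ℝ, 0 ≤ p → 0 ≤ y →
      b ^ 4 ≤ κ * ((p ^ 2 + y ^ 2 / l) * y ^ 6) → |b| ≤ ρ * y ^ 2 + D * p ^ 2 := by
  have hlt : κ * (0 + 1 / l) < ν ^ 4 := by
    rw [zero_add, mul_one_div, div_lt_iff₀ hl]; exact h
  have hcont : Tendsto (fun η : ℝ => κ * (η + 1 / l)) (𝓝[>] 0) (𝓝 (κ * (0 + 1 / l))) :=
    (Continuous.tendsto (by fun_prop) 0).mono_left nhdsWithin_le_nhds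
  obtain ⟨η, hη, hη0⟩ := ((hcont.eventually_lt_const hlt).and self_mem_nhdsWithin).exists
  have hη0 : 0 < η := hη0
  have hr : ∀ a : ℝ, 0 ≤ a → √(√a) ^ 4 = a := fun a ha => by
    rw [show √(√a) ^ 4 = (√(√a) ^ 2) ^ 2 by ring, Real.sq_sqrt (Real.sqrt_nonneg _), Real.sq_sqrt ha]
  have ha1 : 0 ≤ κ * (η + 1 / l) := by positivity
  have ha2 : 0 ≤ κ * ((1 + 1 / (η * l)) / η ^ 3) := by positivity
  refine ⟨√(√(κ * (η + 1 / l))), ?_, √(√(κ * ((1 + 1 / (η * l)) / η ^ 3))), Real.sqrt_nonneg _, ?_⟩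
  · refine lt_of_pow_lt_pow_left₀ 4 hν.le ?_
    rw [hr _ ha1]; exact hη
  intro b p y hp hy hb
  have habs : |b| ^ 4 = b ^ 4 := by rw [← abs_pow, abs_of_nonneg (by positivity)]
  rcases le_total (p ^ 2) (η * y ^ 2) with hc | hc
  · have h1 : |b| ≤ √(√(κ * (η + 1 / l))) * y ^ 2 := by
      refine le_of_pow_le_pow_left₀ (n := 4) (by norm_num) (by positivity) ?_
      rw [habs, mul_pow, hr _ ha1]
      refine hb.trans ?_
      calc κ * ((p ^ 2 + y ^ 2 / l) * y ^ 6) ≤ κ * ((η * y ^ 2 + y ^ 2 / l) * y ^ 6) := by gcongr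
        _ = κ * (η + 1 / l) * (y ^ 2) ^ 4 := by ring
    exact h1.trans (le_add_of_nonneg_right (by positivity))
  · have hy2 : y ^ 2 ≤ p ^ 2 / η := by rw [le_div_iff₀ hη0]; linarith
    have h1 : |b| ≤ √(√(κ * ((1 + 1 / (η * l)) / η ^ 3))) * p ^ 2 := by
      refine le_of_pow_le_pow_left₀ (n := 4) (by norm_num) (by positivity) ?_
      rw [habs, mul_pow, hr _ ha2]
      refine hb.trans ?_
      calc κ * ((p ^ 2 + y ^ 2 / l) * y ^ 6) = κ * ((p ^ 2 + y ^ 2 / l) * (y ^ 2) ^ 3) := by ring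
        _ ≤ κ * ((p ^ 2 + (p ^ 2 / η) / l) * (p ^ 2 / η) ^ 3) := by gcongr
        _ = κ * ((1 + 1 / (η * l)) / η ^ 3) * (p ^ 2) ^ 4 := by field_simp
    exact h1.trans (le_add_of_nonneg_left (by positivity))

/-! ### Voight energy, absorbing ball and the difference of solutions -/

namespace NSV

variable {Ω : Set E3} {w : ℕ → V Ω} {lam : ℕ → ℝ}

theorem IsStokesBasis.lam_pos (hw : IsStokesBasis w lam) (j : ℕ) : 0 < lam j := by
  rw [← hw.norm_grad_sq j]
  have : grad (w j) ≠ 0 := fun h => by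
    have h1 : ‖fld (w j)‖ = 1 := hw.orthonormal.1 j
    rw [fld_eq_zero_of_grad_eq_zero h, norm_zero] at h1
    exact zero_ne_one h1
  positivity

theorem IsStokesBasis.exists_norm_le (hw : IsStokesBasis w lam) :
    ∃ K, 0 ≤ K ∧ ∀ φ : V Ω, ‖φ‖ ≤ K * norm1 φ := by
  have h0 := hw.lam_pos 0
  refine ⟨(√(lam 0))⁻¹ + 1, by positivity, fun φ => ?_⟩
  have h1 : √(lam 0) * ‖fld φ‖ ≤ norm1 φ := by
    refine le_of_pow_le_pow_left₀ (n := 2) (by norm_num) (norm_nonneg _) ?_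
    rw [mul_pow, Real.sq_sqrt h0.le]
    exact hw.poincare hw.lam_pos φ
  have h2 : ‖fld φ‖ ≤ (√(lam 0))⁻¹ * norm1 φ := by
    rw [inv_mul_eq_div, le_div_iff₀ (Real.sqrt_pos.2 h0)]; linarith
  have h3 : 0 ≤ norm1 φ := norm_nonneg _
  have h4 : 0 ≤ (√(lam 0))⁻¹ * norm1 φ := by positivity
  refine max_le ?_ ?_
  · change ‖fld φ‖ ≤ _
    linarith
  · change norm1 φ ≤ _
    linarith

/-- The infimum is attained as a bound. By Poincaré the gradient norm dominates the norm of `V`, so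
the set of admissible constants is nonempty and the infimum is not a default value. -/
theorem IsStokesBasis.abs_apply_le (hw : IsStokesBasis w lam) (l : V Ω →L[ℝ] ℝ) (φ : V Ω) :
    |l φ| ≤ normNeg1 l * norm1 φ := by
  obtain ⟨K, hK0, hK⟩ := hw.exists_norm_le
  have hne : {c : ℝ | 0 ≤ c ∧ ∀ φ : V Ω, |l φ| ≤ c * norm1 φ}.Nonempty :=
    ⟨‖l‖ * K, by positivity, fun φ => (l.le_opNorm φ).trans (by
      rw [mul_assoc]; exact mul_le_mul_of_nonneg_left (hK φ) (norm_nonneg _))⟩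
  rcases (norm_nonneg (grad φ)).eq_or_lt with h | h
  · have h1 : norm1 φ = 0 := h.symm
    obtain ⟨c, hc⟩ := hne
    have := hc.2 φ
    rw [h1, mul_zero] at this ⊢
    exact this
  · have h1 : 0 < norm1 φ := h
    rw [← div_le_iff₀ h1]
    exact le_csInf hne fun c hc => (div_le_iff₀ h1).2 (hc.2 φ)

/-- The bilinear form `(u, v) + α² (∇u, ∇v)` of the Voight energy. -/
noncomputable def energyForm (Ω : Set E3) (α : ℝ) : V Ω →L[ℝ] V Ω →L[ℝ] ℝ :=
  let F : V Ω →L[ℝ] L2Vec Ω := (ContinuousLinearMap.fst ℝ (L2Vec Ω) (L2Grad Ω)).comp (V Ω).subtypeL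
  let G : V Ω →L[ℝ] L2Grad Ω :=
    (ContinuousLinearMap.snd ℝ (L2Vec Ω) (L2Grad Ω)).comp (V Ω).subtypeL
  (innerSL ℝ).bilinearComp F F + α ^ 2 • (innerSL ℝ).bilinearComp G G

theorem energyForm_apply (α : ℝ) (u v : V Ω) :
    energyForm Ω α u v = inner ℝ (fld u) (fld v) + α ^ 2 * inner ℝ (grad u) (grad v) := rfl

theorem energyForm_comm (α : ℝ) (u v : V Ω) : energyForm Ω α u v = energyForm Ω α v u := by
  rw [energyForm_apply, energyForm_apply, real_inner_comm, real_inner_comm (grad v)]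

theorem sq_mul_norm_grad_sq_le_energy (α : ℝ) (v : V Ω) :
    α ^ 2 * ‖grad v‖ ^ 2 ≤ energyForm Ω α v v := by
  rw [energyForm_apply, real_inner_self_eq_norm_sq, real_inner_self_eq_norm_sq]
  have := sq_nonneg ‖fld v‖
  linarith

theorem IsStokesBasis.d1_pos (hw : IsStokesBasis w lam) {α : ℝ} (hα : 0 < α) :
    0 < d1 α (lam 0) :=
  mul_pos (by norm_num) (lt_min (by positivity) (hw.lam_pos 0))

/-- The two parts of the energy, scaled by the minimum, are each at most ‖∇v‖²; the factor ½ in `d1`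
averages them. -/
theorem IsStokesBasis.d1_mul_energy_le (hw : IsStokesBasis w lam) {α : ℝ} (hα : 0 < α) (v : V Ω) :
    d1 α (lam 0) * energyForm Ω α v v ≤ ‖grad v‖ ^ 2 := by
  rw [energyForm_apply, real_inner_self_eq_norm_sq, real_inner_self_eq_norm_sq, d1]
  have h1 : min (1 / α ^ 2) (lam 0) * ‖fld v‖ ^ 2 ≤ ‖grad v‖ ^ 2 :=
    (mul_le_mul_of_nonneg_right (min_le_right _ _) (sq_nonneg _)).trans (hw.poincare hw.lam_pos v)
  have h2 : min (1 / α ^ 2) (lam 0) * (α ^ 2 * ‖grad v‖ ^ 2) ≤ ‖grad v‖ ^ 2 := by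
    refine (mul_le_mul_of_nonneg_right (min_le_left _ _) (by positivity)).trans_eq ?_
    field_simp
  linarith

theorem energy_absolutelyContinuous {f z : ℝ → V Ω} {z₀ : V Ω} (α : ℝ)
    (hf : LocallyIntegrableOn f (Ici 0))
    (hz : ∀ t, 0 ≤ t → z t = z₀ + ∫ s in (0 : ℝ)..t, f s) (a b : ℝ) (ha : 0 ≤ a) (hb : 0 ≤ b) :
    AbsolutelyContinuousOnInterval (fun t => energyForm Ω α (z t) (z t)) a b :=
  (primitive_absolutelyContinuous hf hz ha hb).bilin_self _

theorem energy_ae_hasDerivAt {f z : ℝ → V Ω} {z₀ : V Ω} (α : ℝ)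
    (hf : LocallyIntegrableOn f (Ici 0))
    (hz : ∀ t, 0 ≤ t → z t = z₀ + ∫ s in (0 : ℝ)..t, f s) :
    ∀ᵐ t ∂(volume.restrict (Ici (0 : ℝ))),
      HasDerivAt (fun t => energyForm Ω α (z t) (z t)) (2 * energyForm Ω α (f t) (z t)) t := by
  filter_upwards [primitive_ae_hasDerivAt hf hz] with t ht
  exact ht.bilin_self (energyForm_comm α)

/-- The absorbing ball estimate for the Voight energy. -/
theorem IsStokesBasis.eventually_energy_le (hw : IsStokesBasis w lam) {ν α hb L : ℝ} (hν : 0 < ν)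
    (hα : 0 < α) {h : ℝ → (V Ω →L[ℝ] ℝ)} {v₀ : V Ω} {v : ℝ → V Ω} (hv : IsSolution ν α h v₀ v)
    (hh : ∀ t, 0 ≤ t → normNeg1 (h t) ≤ hb) (hL : hb ^ 2 / (ν ^ 2 * d1 α (lam 0)) < L) :
    ∀ᶠ t in atTop, energyForm Ω α (v t) (v t) ≤ L := by
  obtain ⟨vt, hvt, hprim, heq⟩ := hv
  have hd := hw.d1_pos hα
  refine eventually_le_of_ae_deriv_le (c := ν * d1 α (lam 0)) (κ := hb ^ 2 / ν)
    (by positivity) (energy_absolutelyContinuous α hvt hprim) le_rfl ?_ ?_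
  · filter_upwards [energy_ae_hasDerivAt α hvt hprim, heq, ae_restrict_mem measurableSet_Ici]
      with t h1 h2 ht _
    refine ⟨_, h1, ?_⟩
    have h3 := h2 (v t)
    rw [trilin_self, real_inner_self_eq_norm_sq] at h3
    have h4 : h t (v t) ≤ hb * ‖grad (v t)‖ := (le_abs_self _).trans
      ((hw.abs_apply_le (h t) (v t)).trans
        (mul_le_mul_of_nonneg_right (hh t ht) (norm_nonneg _)))
    have h5 := mul_le_mul_of_nonneg_left (hw.d1_mul_energy_le hα (v t)) hν.le
    -- Young's inequality spends half of the dissipation 2ν‖∇v‖² on the force.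
    have h6 : 2 * (hb * ‖grad (v t)‖) ≤ ν * ‖grad (v t)‖ ^ 2 + hb ^ 2 / ν := by
      have : ν * ‖grad (v t)‖ ^ 2 + hb ^ 2 / ν - 2 * (hb * ‖grad (v t)‖) =
          (ν * ‖grad (v t)‖ - hb) ^ 2 / ν := by
        field_simp; ring
      have : 0 ≤ (ν * ‖grad (v t)‖ - hb) ^ 2 / ν := by positivity
      linarith
    rw [energyForm_apply]
    linarith
  · refine lt_of_eq_of_lt ?_ hL
    field_simp

theorem IsStokesBasis.trilin_diff_pow_four_le (hw : IsStokesBasis w lam) {α L : ℝ} (hα : 0 < α)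
    (m : ℕ) {v : V Ω} (hv : energyForm Ω α v v ≤ L) (z : V Ω) :
    trilin z v z ^ 4 ≤ (sobolevConst : ℝ) ^ 6 * L ^ 2 / α ^ 4 *
      ((‖modeProj w m (fld z)‖ ^ 2 + ‖grad z‖ ^ 2 / lam m) * ‖grad z‖ ^ 6) := by
  have h1 : ‖grad v‖ ^ 2 ≤ L / α ^ 2 := by
    rw [le_div_iff₀ (by positivity), mul_comm]
    exact (sq_mul_norm_grad_sq_le_energy α v).trans hv
  have h2 := hw.norm_fld_sq_le hw.lam_pos m z
  have hL : 0 ≤ L / α ^ 2 := (sq_nonneg _).trans h1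
  calc trilin z v z ^ 4
      ≤ (sobolevConst : ℝ) ^ 6 * (‖grad v‖ ^ 4 * (‖fld z‖ ^ 2 * ‖grad z‖ ^ 6)) :=
        trilin_pow_four_le v z
    _ = (sobolevConst : ℝ) ^ 6 * ((‖grad v‖ ^ 2) ^ 2 * (‖fld z‖ ^ 2 * ‖grad z‖ ^ 6)) := by ring
    _ ≤ (sobolevConst : ℝ) ^ 6 * ((L / α ^ 2) ^ 2 *
        ((‖modeProj w m (fld z)‖ ^ 2 + ‖grad z‖ ^ 2 / lam m) * ‖grad z‖ ^ 6)) := by gcongr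
    _ = _ := by ring

/-- The energy balance of the difference of two solutions. -/
theorem IsSolution.sub_energy {ν α : ℝ} {h g : ℝ → (V Ω →L[ℝ] ℝ)} {v₀ u₀ : V Ω} {v u : ℝ → V Ω}
    (hv : IsSolution ν α h v₀ v) (hu : IsSolution ν α g u₀ u) :
    (∀ a b, 0 ≤ a → 0 ≤ b → AbsolutelyContinuousOnInterval
      (fun t => energyForm Ω α (v t - u t) (v t - u t)) a b) ∧
    ∀ᵐ t ∂(volume.restrict (Ici (0 : ℝ))),
      HasDerivAt (fun t => energyForm Ω α (v t - u t) (v t - u t))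
        (2 * ((h t - g t) (v t - u t) - ν * ‖grad (v t - u t)‖ ^ 2
          - trilin (v t - u t) (v t) (v t - u t))) t := by
  obtain ⟨vt, hvt, hvp, hve⟩ := hv
  obtain ⟨ut, hut, hup, hue⟩ := hu
  have hd : LocallyIntegrableOn (fun t => vt t - ut t) (Ici 0) := hvt.sub hut
  have hp : ∀ t, 0 ≤ t → v t - u t = (v₀ - u₀) + ∫ s in (0 : ℝ)..t, (vt s - ut s) := by
    intro t ht
    rw [hvp t ht, hup t ht, intervalIntegral.integral_sub
      (hvt.intervalIntegrable_of_nonneg le_rfl ht) (hut.intervalIntegrable_of_nonneg le_rfl ht)]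
    abel
  refine ⟨energy_absolutelyContinuous α hd hp, ?_⟩
  filter_upwards [energy_ae_hasDerivAt α hd hp, hve, hue] with t h1 h2 h3
  convert h1 using 1
  -- Both equations are tested with the difference.
  have e1 := h2 (v t - u t)
  have e2 := h3 (v t - u t)
  have e3 := trilin_self_sub (v t) (u t)
  have f1 : ‖grad (v t - u t)‖ ^ 2 =
      inner ℝ (grad (v t)) (grad (v t - u t)) - inner ℝ (grad (u t)) (grad (v t - u t)) := by
    rw [← real_inner_self_eq_norm_sq, ← inner_sub_left]
    rfl
  have f2 : inner ℝ (fld (vt t - ut t)) (fld (v t - u t)) =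
      inner ℝ (fld (vt t)) (fld (v t - u t)) - inner ℝ (fld (ut t)) (fld (v t - u t)) := by
    rw [← inner_sub_left]
    rfl
  have f3 : inner ℝ (grad (vt t - ut t)) (grad (v t - u t)) =
      inner ℝ (grad (vt t)) (grad (v t - u t)) - inner ℝ (grad (ut t)) (grad (v t - u t)) := by
    rw [← inner_sub_left]
    rfl
  rw [energyForm_apply, f1, f2, f3, sub_apply]
  linarith

/-- A level above the absorbing radius for which the spectral condition persists. -/
theorem exists_level_of_lt {ν α hb d l C : ℝ} (hν : 0 < ν) (hα : 0 < α) (hd : 0 < d)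
    (h : C * (hb ^ 4 / (α ^ 4 * ν ^ 8 * d ^ 2)) < l) :
    ∃ L, hb ^ 2 / (ν ^ 2 * d) < L ∧ C * L ^ 2 / α ^ 4 < ν ^ 4 * l := by
  have hcont : Tendsto (fun L : ℝ => C * L ^ 2 / α ^ 4) (𝓝[>] (hb ^ 2 / (ν ^ 2 * d)))
      (𝓝 (C * (hb ^ 2 / (ν ^ 2 * d)) ^ 2 / α ^ 4)) :=
    (Continuous.tendsto (by fun_prop) _).mono_left nhdsWithin_le_nhds
  -- At the absorbing radius itself the inequality is `h` multiplied by ν⁴; continuity in L then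
  -- gives a slightly larger level.
  have hlt : C * (hb ^ 2 / (ν ^ 2 * d)) ^ 2 / α ^ 4 < ν ^ 4 * l := by
    refine lt_of_eq_of_lt ?_ (mul_lt_mul_of_pos_left h (show 0 < ν ^ 4 by positivity))
    field_simp
  obtain ⟨L, h1, h2⟩ := ((hcont.eventually_lt_const hlt).and self_mem_nhdsWithin).exists
  exact ⟨L, h2, h1⟩

end NSV

/-! ### The determining modes theorem -/

theorem theorem4p1 :
    ∃ C : ℝ, 0 < C ∧
      ∀ (Ω : Set NSV.E3), IsOpen Ω → Bornology.IsBounded Ω →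
      ∀ (w : ℕ → NSV.V Ω) (lam : ℕ → ℝ), NSV.IsStokesBasis w lam →
      ∀ (ν α : ℝ), 0 < ν → 0 < α →
      ∀ (hb : ℝ) (m : ℕ),
        lam m > C * (hb ^ 4 / (α ^ 4 * ν ^ 8 * NSV.d1 α (lam 0) ^ 2)) →
      ∀ (h g : ℝ → (NSV.V Ω →L[ℝ] ℝ)) (v₀ u₀ : NSV.V Ω) (v u : ℝ → NSV.V Ω),
        NSV.IsSolution ν α h v₀ v → NSV.IsSolution ν α g u₀ u →
        (∀ t, 0 ≤ t → NSV.normNeg1 (h t) ≤ hb) →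
        Tendsto (fun t => NSV.normNeg1 (h t - g t)) atTop (𝓝 0) →
        Tendsto (fun t => ‖NSV.modeProj w m (NSV.fld (v t - u t))‖) atTop (𝓝 0) →
        Tendsto (fun t => NSV.norm1 (v t - u t)) atTop (𝓝 0) := by
  -- The summand 1 only secures C > 0.
  refine ⟨(NSV.sobolevConst : ℝ) ^ 6 + 1, by positivity, ?_⟩
  intro Ω _ _ w lam hw ν α hν hα hb m hlam h g v₀ u₀ v u hv hu hh hforce hproj
  have hd := hw.d1_pos hα
  obtain ⟨L, hL, hLlam⟩ := NSV.exists_level_of_lt hν hα hd hlam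
  have hκ : (NSV.sobolevConst : ℝ) ^ 6 * L ^ 2 / α ^ 4 < ν ^ 4 * lam m := by
    refine lt_of_le_of_lt ?_ hLlam
    gcongr
    linarith
  obtain ⟨ρ, hρ, D, hD, hbound⟩ := exists_bound_of_pow_four_le (by positivity) hν (hw.lam_pos m) hκ
  have hδ : 0 < ν - ρ := sub_pos.2 hρ
  obtain ⟨T, hT⟩ := (hw.eventually_energy_le hν hα hv hh hL).exists_forall_of_atTop
  obtain ⟨hac, hder⟩ := hv.sub_energy hu
  let E : ℝ → ℝ := fun t => NSV.energyForm Ω α (v t - u t) (v t - u t)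
  -- All that is left of E' after the dissipation (ν-ρ)‖∇z‖²: the force difference after Young's
  -- inequality, and the P_m part of the nonlinear term.
  let F : ℝ → ℝ := fun t => NSV.normNeg1 (h t - g t) ^ 2 / (ν - ρ) +
    2 * (D * ‖NSV.modeProj w m (NSV.fld (v t - u t))‖ ^ 2)
  have hF : Tendsto F atTop (𝓝 0) := by
    simpa using ((hforce.pow 2).div_const (ν - ρ)).add (((hproj.pow 2).const_mul D).const_mul 2)
  have hE : ∀ K, 0 < K → ∀ᶠ t in atTop, E t ≤ K := by
    intro K hK
    have hκ' : 0 < (ν - ρ) * NSV.d1 α (lam 0) * (K / 2) := by positivity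
    -- Eventually F stays below the decay rate times K/2, so E eventually stays below K.
    obtain ⟨T', hT'⟩ := (hF.eventually_le_const hκ').exists_forall_of_atTop
    refine eventually_le_of_ae_deriv_le (c := (ν - ρ) * NSV.d1 α (lam 0)) (T := max 0 (max T T'))
      (κ := (ν - ρ) * NSV.d1 α (lam 0) * (K / 2)) (by positivity) hac (le_max_left _ _) ?_ ?_
    · filter_upwards [hder] with t ht hTt
      refine ⟨_, ht, ?_⟩
      have hTt' := (le_max_right _ _).trans hTt
      have hFt : F t ≤ _ := hT' t ((le_max_right _ _).trans hTt')
      have hb4 := hbound _ _ _ (norm_nonneg _) (norm_nonneg _)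
        (hw.trilin_diff_pow_four_le hα m (hT t ((le_max_left _ _).trans hTt')) (v t - u t))
      have hforce' := (le_abs_self _).trans (hw.abs_apply_le (h t - g t) (v t - u t))
      have hdE := mul_le_mul_of_nonneg_left (hw.d1_mul_energy_le hα (v t - u t)) hδ.le
      have habs := neg_abs_le (NSV.trilin (v t - u t) (v t) (v t - u t))
      simp only [F, NSV.norm1] at hFt hforce'
      set n := NSV.normNeg1 (h t - g t)
      set y := ‖NSV.grad (v t - u t)‖
      have hyoung : 2 * (n * y) ≤ (ν - ρ) * y ^ 2 + n ^ 2 / (ν - ρ) := by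
        have e : (ν - ρ) * y ^ 2 + n ^ 2 / (ν - ρ) - 2 * (n * y) =
            ((ν - ρ) * y - n) ^ 2 / (ν - ρ) := by
          have := hδ.ne'
          field_simp; ring
        have : 0 ≤ ((ν - ρ) * y - n) ^ 2 / (ν - ρ) := by positivity
        linarith
      linarith
    · rw [mul_div_cancel_left₀ _ (by positivity)]
      linarith
  rw [Metric.tendsto_nhds]
  intro ε hε
  filter_upwards [hE (α ^ 2 * (ε / 2) ^ 2) (by positivity)] with t ht
  have h1 := (NSV.sq_mul_norm_grad_sq_le_energy α (v t - u t)).trans ht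
  have h2 : NSV.norm1 (v t - u t) ≤ ε / 2 :=
    le_of_pow_le_pow_left₀ two_ne_zero (by positivity) (le_of_mul_le_mul_left h1 (by positivity))
  have h3 : 0 ≤ NSV.norm1 (v t - u t) := norm_nonneg _
  rw [Real.dist_0_eq_abs, abs_of_nonneg h3]
  linarith
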